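/- **Setting.** The plane is tiled by the unit squares $[c,c+1]\times[r,r+1]$, $(c,r)\in\mathbb Z^2$; all of them except $(c,r)=(-1,0)$ are bricks. Fix a slope $0<S<1$. A ball is launched from $(0,y)$, $0<y<S$, with direction $(1,S)$, so that it hits the brick $[0,1]^2$ on a vertical edge immediately. Whenever the ball hits an edge of a remaining brick it is reflected as in a billiard and that brick is destroyed. Orbits are assumed to contain no point of $\mathbb Z^2$. For $n\in\mathbb N$, let $T_x(n)\in\mathbb Z$ be the abscissa of the ball after it has traveled a horizontal distance $n$, and let $T_y(n)=y+Sn$ (the ordinate after unfolding the bounces on horizontal edges). **Blocks.** For integers $0\le\rho\le\alpha$ put $$|\alpha,\rho|=\frac{\alpha(\alpha+1)}2+\rho+1,\qquad X(|\alpha,\rho|)=\sum_{n=1}^{\alpha}(-1)^n n+(-1)^{\alpha+1}(\rho+1).$$ A *ternary block* is a triple $\Delta=((\alpha_i,\rho_i))_{0\le i\le 2}$ of such pairs for which there are $S'\in(0,1)$ and $y'\in(0,S')$ with $i+1<y'+S'|\alpha_i,\rho_i|<i+1+S'$ for $i=0,1,2$. Put $|\Delta|=|\alpha_2,\rho_2|$.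 The block is *elementary* if $\alpha_2-2\rho_2=\alpha_0-2\rho_0$ when $\alpha_0\equiv\alpha_2\pmod 2$, and $\alpha_2-2\rho_2=-\alpha_0+2\rho_0+1$ when $\alpha_0\not\equiv\alpha_2\pmod 2$. **Elementary slopes.** A slope $S\in(0,1)$ is *elementary* if for some $y\in(0,S)$ whose orbit contains no point of $\mathbb Z^2$ there is a sequence of elementary blocks $\Delta_N=((\alpha_{i,N},\rho_{i,N}))_{0\le i\le 2}$, $N\in\mathbb N$, through which the orbit successively goes: with $\Sigma_N=\sum_{j<N}|\Delta_j|$ and $\alpha_N=\sum_{j<N}(\alpha_{2,j}+1)$, for all $N\in\mathbb N$ and $0\le i\le 2$, $$3N+i+1<T_y(\Sigma_N+|\alpha_{i,N},\rho_{i,N}|)<3N+i+1+S$$ (the blocks are those cut out by the successive horizontal grid lines that the orbit reaches) and $$T_x(\Sigma_N+|\alpha_{i,N},\rho_{i,N}|)=T_x(\Sigma_N)+(-1)^{\alpha_N}X(|\alpha_{i,N},\rho_{i,N}|).$$ **Theorem.** Every elementary slope is rational. If $S=\frac pq$, with $p,q$ coprime positive integers, is elementary, then $p=1$ or $3\mid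 p$; and if $p\neq1$, then $q\equiv 1$ or $q\equiv p-1\pmod p$. -/

import Mathlib

namespace Breakout

/-! ## The breakout ball in the plane

Bricks are the unit squares `[c, c+1] × [r, r+1]`, indexed by their lower left corner `(c, r)`. -/

/-- The state of the game at a moment when the ball is on a vertical grid line: its abscissa `x`,
its ordinate `y`, the signs `u`, `v` (equal to `1` or `-1`) of the horizontal and vertical components
of its direction, and the set of bricks which have not been destroyed yet. -/
structure Ball where
  x : ℤ
  y : ℝ
  u : ℤ
  v : ℤ
  bricks : Set (ℤ × ℤ)

/-- Column of unit squares that lies just ahead of a ball standing on a vertical grid line. -/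
def Ball.column (b : Ball) : ℤ := if b.u = 1 then b.x else b.x - 1

/-- Row of unit squares containing the ball. -/
noncomputable def Ball.row (b : Ball) : ℤ := ⌊b.y⌋

open Classical in
/-- Effect of arriving at a vertical grid line: if the square ahead is a brick, the brick is
destroyed and the ball bounces horizontally. -/
noncomputable def Ball.hitVertical (b : Ball) : Ball :=
  if (b.column, b.row) ∈ b.bricks then
    { b with u := -b.u, bricks := b.bricks \ {(b.column, b.row)} }
  else b

open Classical in
/-- Flight across one column of unit squares, with a direction of slope `± S`, `0 < S < 1`, up to the
arrival at the next vertical grid line.  As `S < 1`, at most one horizontal grid line is reached on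
the way.  If it is reached and the square behind it is a brick, the brick is destroyed and the ball
bounces vertically, so that the rest of its path is reflected along that line. -/
noncomputable def Ball.fly (S : ℝ) (b : Ball) : Ball :=
  if ⌊b.y + b.v * S⌋ = b.row then
    { b with x := b.x + b.u, y := b.y + b.v * S }
  else if (b.column, b.row + b.v) ∈ b.bricks then
    { b with
      x := b.x + b.u
      y := 2 * ((if b.v = 1 then b.row + 1 else b.row : ℤ) : ℝ) - (b.y + b.v * S)
      v := -b.v
      bricks := b.bricks \ {(b.column, b.row + b.v)} }
  else
    { b with x := b.x + b.u, y := b.y + b.v * S }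

/-- The ball is launched northeast from `(0, y)`; all squares are bricks except `(-1, 0)`.  The brick
`(0, 0)` is hit on a vertical edge immediately. -/
noncomputable def launch (y : ℝ) : Ball :=
  Ball.hitVertical { x := 0, y := y, u := 1, v := 1, bricks := {z | z ≠ (-1, 0)} }

/-- The state of the game when the ball has traveled a horizontal distance `n`. -/
noncomputable def orbit (S y : ℝ) (n : ℕ) : Ball :=
  (fun b => (b.fly S).hitVertical)^[n] (launch y)

/-- Traveling abscissa: abscissa of the ball after a horizontal distance `n`. -/
noncomputable def Tx (S y : ℝ) (n : ℕ) : ℤ := (orbit S y n).x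

/-- Traveling ordinate: the ordinate after a horizontal distance `n` once all the bounces on
horizontal edges have been unfolded (total vertical distance traveled, plus the initial ordinate). -/
def Ty (S y : ℝ) (n : ℕ) : ℝ := y + S * n

/-! ## Elementary blocks -/

/-- The number `|α, ρ|`. -/
def dist (α ρ : ℕ) : ℕ := α * (α + 1) / 2 + (ρ + 1)

/-- The number `X(|α, ρ|)`. -/
def X (α ρ : ℕ) : ℤ :=
  (∑ n ∈ Finset.Icc 1 α, (-1 : ℤ) ^ n * (n : ℤ)) + (-1) ^ (α + 1) * ((ρ : ℤ) + 1)

/-- A triple of pairs `(α i, ρ i)`, `0 ≤ i ≤ 2`. -/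
structure Block where
  α : Fin 3 → ℕ
  ρ : Fin 3 → ℕ

/-- The horizontal distance `|α i, ρ i|`. -/
def Block.dist (Δ : Block) (i : Fin 3) : ℕ := Breakout.dist (Δ.α i) (Δ.ρ i)

/-- The length `|Δ| = |α 2, ρ 2|`. -/
def Block.length (Δ : Block) : ℕ := Δ.dist 2

/-- `S` is primary for `Δ`, with initial ordinate `y`: for each `i`, the `i`-th horizontal grid line is
reached within the last unit of the horizontal distance `|α i, ρ i|`. -/
def Block.IsPrimaryAt (Δ : Block) (S y : ℝ) : Prop :=
  0 < y ∧ y < S ∧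
    ∀ i : Fin 3, ((i : ℕ) : ℝ) + 1 < Ty S y (Δ.dist i) ∧ Ty S y (Δ.dist i) < ((i : ℕ) : ℝ) + 1 + S

/-- Ternary blocks. -/
def Block.IsTernary (Δ : Block) : Prop :=
  (∀ i, Δ.ρ i < Δ.α i + 1) ∧ ∃ S y : ℝ, 0 < S ∧ S < 1 ∧ Δ.IsPrimaryAt S y

/-- Elementary blocks: the third horizontal edge belongs to the (broken) top brick. -/
def Block.IsElementary (Δ : Block) : Prop :=
  Δ.IsTernary ∧
    (Δ.α 0 % 2 = Δ.α 2 % 2 →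
      (Δ.α 2 : ℤ) - 2 * Δ.ρ 2 = Δ.α 0 - 2 * Δ.ρ 0) ∧
    (Δ.α 0 % 2 ≠ Δ.α 2 % 2 →
      (Δ.α 2 : ℤ) - 2 * Δ.ρ 2 = -Δ.α 0 + 2 * Δ.ρ 0 + 1)

/-! ## Elementary slopes -/

/-- `α_N = ∑_{j < N} (α_{2,j} + 1)`. -/
def alphaSum (Δ : ℕ → Block) (N : ℕ) : ℕ := ∑ j ∈ Finset.range N, ((Δ j).α 2 + 1)

/-- `Σ_N = ∑_{j < N} |Δ_j|`. -/
def lengthSum (Δ : ℕ → Block) (N : ℕ) : ℕ := ∑ j ∈ Finset.range N, (Δ j).length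

/-- The orbit of slope `S` launched from `(0, y)` successively goes through the blocks `Δ 0, Δ 1, …`:
the `(3 N + i)`-th horizontal grid line is reached where the block `Δ N` says, that is, `Δ N` is the
`N`-th block cut out by the horizontal grid lines, and the abscissa there is that of `Δ N` stacked
on top of the previous blocks. -/
def GoesThrough (S y : ℝ) (Δ : ℕ → Block) : Prop :=
  ∀ (N : ℕ) (i : Fin 3),
    (3 * (N : ℝ) + ((i : ℕ) : ℝ) + 1 < Ty S y (lengthSum Δ N + (Δ N).dist i) ∧
      Ty S y (lengthSum Δ N + (Δ N).dist i) < 3 * (N : ℝ) + ((i : ℕ) : ℝ) + 1 + S) ∧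
    Tx S y (lengthSum Δ N + (Δ N).dist i) =
      Tx S y (lengthSum Δ N) + (-1) ^ alphaSum Δ N * X ((Δ N).α i) ((Δ N).ρ i)

/-- `S` is elementary: for some initial ordinate in `(0, S)`, with an orbit that contains no
point of `ℤ²`, the orbit consists of stacked elementary blocks. -/
def IsElementarySlope (S : ℝ) : Prop :=
  0 < S ∧ S < 1 ∧ ∃ (y : ℝ) (Δ : ℕ → Block),
    0 < y ∧ y < S ∧ (∀ (n : ℕ) (m : ℤ), Ty S y n ≠ m) ∧
    (∀ N, (Δ N).IsElementary) ∧ GoesThrough S y Δ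

end Breakout

namespace Breakout

/-! Let w be the height of the ball above the bottom line of its current block, so 0 < w < S. It
determines the distances to the first and third lines: each takes one of two consecutive values,
according to the side of a threshold on which w lies (1 and 3 reduced modulo S). From block to
block, w is rotated by -3 modulo S.

Elementarity forbids two things: the third distance increasing by one while the first stays fixed
(`Linked.not_succ_right`), and a step from (k, 3k+1) to (k+1, 3k+2)
(`Linked.not_three_mul_add_one`).

For irrational S the values of w are dense, so both sides of the third threshold are met with the
same first distance, or else the thresholds coincide and S is rational. For S = p/q the rotation
acts on p cells. If 3 does not divide p, every cell is visited and one of the prohibitions is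
violated unless p = 1. If 3 divides p, a single class modulo 3 is visited; the two visited cells
around the third threshold must also straddle the first, which forces q ≡ ±1 modulo p. -/

/-- The distances `m`, `n` to the first and to the third horizontal edge are compatible with an
elementary block. -/
def Linked (m n : ℕ) : Prop :=
  ∃ A R B P : ℕ, R ≤ A ∧ P ≤ B ∧ dist A R = m ∧ dist B P = n ∧
    (A % 2 = B % 2 → (B : ℤ) - 2 * P = A - 2 * R) ∧
    (A % 2 ≠ B % 2 → (B : ℤ) - 2 * P = -A + 2 * R + 1)

/-! ### Arithmetic of linked distances -/

theorem two_mul_dist (α ρ : ℕ) : 2 * dist α ρ = α * (α + 1) + 2 * ρ + 2 := by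
  have h := Nat.div_mul_cancel (Nat.even_mul_succ_self α).two_dvd
  unfold dist
  omega

/-- `dist` numbers the pairs with ρ ≤ α in lexicographic order. -/
theorem dist_lt_dist_of_lt {A R B P : ℕ} (hR : R ≤ A) (h : A < B) : dist A R < dist B P := by
  have h1 := two_mul_dist A R
  have h2 := two_mul_dist B P
  nlinarith [Nat.mul_le_mul h (Nat.succ_le_succ h)]

theorem dist_injective {A R B P : ℕ} (hR : R ≤ A) (hP : P ≤ B) (h : dist A R = dist B P) :
    A = B ∧ R = P := by
  rcases lt_trichotomy A B with h' | rfl | h'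
  · exact absurd h (dist_lt_dist_of_lt hR h').ne
  · have h1 := two_mul_dist A R
    have h2 := two_mul_dist A P
    omega
  · exact absurd h (dist_lt_dist_of_lt hP h').ne'

theorem dist_eq_succ {A R B P : ℕ} (hR : R ≤ A) (hP : P ≤ B) (h : dist B P = dist A R + 1) :
    (B = A ∧ P = R + 1) ∨ (B = A + 1 ∧ P = 0 ∧ R = A) := by
  rcases hR.lt_or_eq with hlt | rfl
  · have : dist A (R + 1) = dist B P := by rw [h]; rfl
    have := dist_injective hlt hP this
    omega
  · have : dist (R + 1) 0 = dist B P := by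
      have h1 := two_mul_dist (R + 1) 0
      have h2 := two_mul_dist R R
      have h3 : (R + 1) * (R + 1 + 1) = R * (R + 1) + 2 * (R + 1) := by ring
      omega
    have := dist_injective (Nat.zero_le _) hP this
    omega

/-- The successor of (B, P) is (B, P+1), which changes B - 2P but no parity, or (B+1, 0) when P = B,
where size rules out the parity conditions. -/
theorem Linked.not_succ_right {m n : ℕ} (hmn : m < n) (h : Linked m n) :
    ¬ Linked m (n + 1) := by
  rintro ⟨A', R', B', P', hR', hP', hA', hB', e1', e2'⟩
  obtain ⟨A, R, B, P, hR, hP, hA, hB, e1, e2⟩ := h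
  obtain ⟨rfl, rfl⟩ := dist_injective hR hR' (hA.trans hA'.symm)
  have hle : A ≤ B := by
    by_contra hlt
    have := dist_lt_dist_of_lt (P := R) hP (not_le.1 hlt)
    omega
  rcases dist_eq_succ hP hP' (by omega) with ⟨rfl, rfl⟩ | ⟨rfl, rfl, rfl⟩
  · by_cases hp : A % 2 = B' % 2
    · have := e1 hp; have := e1' hp; omega
    · have := e2 hp; have := e2' hp; omega
  · by_cases hp : A % 2 = P % 2
    · have h0 := e1 hp
      -- Then m = n, against `hmn`.
      have : A = P ∧ R = P := by omega
      obtain ⟨rfl, rfl⟩ := this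
      omega
    · have := e1' (by omega)
      omega

/-- For equal parities the first link alone fails modulo 4, once P is eliminated. For different
parities, passing to the successors on both sides breaks the linear relation. -/
theorem Linked.not_three_mul_add_one {k : ℕ} (h : Linked k (3 * k + 1)) :
    ¬ Linked (k + 1) (3 * k + 2) := by
  rintro ⟨A', R', B', P', hR', hP', hA', hB', e1', e2'⟩
  obtain ⟨A, R, B, P, hR, hP, hA, hB, e1, e2⟩ := h
  by_cases hp : A % 2 = B % 2
  · have e := e1 hp
    have h1 := two_mul_dist A R
    have h2 := two_mul_dist B P
    have h3 : 3 * (A * (A + 1)) + 6 * R + 8 = B * (B + 1) + 2 * P + 2 := by omega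
    have h4 : 3 * ((A : ℤ) * (A + 1)) + 4 * R + A + 6 = B * (B + 1) + B := by
      have : 3 * ((A : ℤ) * (A + 1)) + 6 * R + 8 = B * (B + 1) + 2 * P + 2 := by exact_mod_cast h3
      linarith
    rcases Nat.even_or_odd' A with ⟨a, rfl | rfl⟩
    · obtain ⟨b, rfl⟩ : ∃ b, B = 2 * b := ⟨B / 2, by omega⟩
      push_cast at h4
      ring_nf at h4
      omega
    · obtain ⟨b, rfl⟩ : ∃ b, B = 2 * b + 1 := ⟨B / 2, by omega⟩
      push_cast at h4
      ring_nf at h4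
      omega
  · have e := e2 hp
    rcases dist_eq_succ hR hR' (by omega) with h1 | h1 <;>
    rcases dist_eq_succ hP hP' (by omega) with h2 | h2
    · have := e2' (by omega); omega
    · have := e1' (by omega); omega
    · have := e1' (by omega); omega
    · have := e2' (by omega); omega

/-! ### From orbits to distances -/

/-- An orbit through elementary blocks, reduced to the distances `a N`, `b N` from the bottom of the
`N`-th block to its first and to its third horizontal edge. -/
theorem IsElementarySlope.exists_distances {S : ℝ} (hS : IsElementarySlope S) :
    ∃ (y : ℝ) (a b L : ℕ → ℕ), L 0 = 0 ∧ (∀ N, L (N + 1) = L N + b N) ∧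
      (∀ N, Linked (a N) (b N)) ∧
      (∀ N, 0 < y + S * L N - 3 * N ∧ y + S * L N - 3 * N < S) ∧
      (∀ N, 1 < y + S * L N - 3 * N + S * a N ∧ y + S * L N - 3 * N + S * a N < 1 + S) ∧
      (∀ N, 3 < y + S * L N - 3 * N + S * b N ∧ y + S * L N - 3 * N + S * b N < 3 + S) := by
  obtain ⟨-, -, y, Δ, hy0, hyS, -, hel, hgo⟩ := hS
  have hL : ∀ N, lengthSum Δ (N + 1) = lengthSum Δ N + (Δ N).dist 2 := fun N => by
    simp only [lengthSum, Finset.sum_range_succ, Block.length]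
  have h2 : ∀ N : ℕ, 3 < y + S * lengthSum Δ N - 3 * N + S * (Δ N).dist 2 ∧
      y + S * lengthSum Δ N - 3 * N + S * (Δ N).dist 2 < 3 + S := fun N => by
    obtain ⟨⟨h, h'⟩, -⟩ := hgo N 2
    simp only [Ty, Nat.cast_add, Fin.val_two, Nat.cast_ofNat] at h h'
    constructor <;> linarith
  refine ⟨y, fun N => (Δ N).dist 0, fun N => (Δ N).dist 2, lengthSum Δ, ?_, hL, ?_, ?_, ?_, h2⟩
  · simp [lengthSum]
  · intro N
    obtain ⟨⟨hρ, -⟩, e1, e2⟩ := hel N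
    exact ⟨_, _, _, _, Nat.lt_succ_iff.1 (hρ 0), Nat.lt_succ_iff.1 (hρ 2), rfl, rfl, e1, e2⟩
  · rintro (_ | N)
    · simpa [lengthSum] using ⟨hy0, hyS⟩
    · have := h2 N
      rw [hL]
      push_cast
      constructor <;> linarith
  · intro N
    obtain ⟨⟨h, h'⟩, -⟩ := hgo N 0
    simp only [Ty, Nat.cast_add, Fin.val_zero, Nat.cast_zero] at h h'
    constructor <;> linarith

/-! ### Irrational slopes: density -/

/-- Forward orbits of an irrational rotation of `ℝ / S ℤ` meet every interval. -/
theorem exists_nat_sub_mul_add_mul_mem_Ioo {S c : ℝ} (hS : 0 < S) (hc : Irrational (c / S))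
    (y : ℝ) {u v : ℝ} (huv : u < v) :
    ∃ (n : ℕ) (m : ℤ), y - c * n + S * m ∈ Set.Ioo u v := by
  have : Fact (0 < S) := ⟨hS⟩
  have hd : DenseRange (· • ((-c : ℝ) : AddCircle S) : ℕ → AddCircle S) := by
    rw [← denseRange_zsmul_iff_nsmul, AddCircle.denseRange_zsmul_coe_iff, neg_div]
    exact hc.neg
  have ho : IsOpen ((QuotientAddGroup.mk : ℝ → AddCircle S) '' Set.Ioo (u - y) (v - y)) :=
    QuotientAddGroup.isOpenMap_coe _ isOpen_Ioo
  obtain ⟨n, x, hx, hn⟩ := hd.exists_mem_open ho ((Set.nonempty_Ioo.2 (by linarith)).image _)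
  have hn' : ((x - n • (-c) : ℝ) : AddCircle S) = 0 := by
    rw [AddCircle.coe_sub, AddCircle.coe_nsmul]
    exact sub_eq_zero.2 hn
  obtain ⟨m, hm⟩ := (AddCircle.coe_eq_zero_iff S).1 hn'
  refine ⟨n, m, ?_⟩
  rw [zsmul_eq_mul, nsmul_eq_mul] at hm
  constructor <;> linarith [hx.1, hx.2]

theorem eq_of_mul_mem_Ioo {S w u : ℝ} {d D : ℕ} (hS : 0 < S) (hu0 : D * S ≤ u)
    (hw0 : 0 < w) (hwS : w < S) (huS : u < (D + 1) * S) (h1 : u < w + S * d)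
    (h2 : w + S * d < u + S) :
    (w < u - D * S → d = D + 1) ∧ (u - D * S < w → d = D) := by
  constructor <;> intro h
  · have h3 : (D : ℝ) < d := lt_of_mul_lt_mul_left (a := S) (by linarith) hS.le
    have h4 : (d : ℝ) < D + 2 := lt_of_mul_lt_mul_left (a := S) (by linarith) hS.le
    norm_cast at h3 h4
    omega
  · have h3 : (D : ℝ) < d + 1 := lt_of_mul_lt_mul_left (a := S) (by linarith) hS.le
    have h4 : (d : ℝ) < D + 1 := lt_of_mul_lt_mul_left (a := S) (by linarith) hS.le
    norm_cast at h3 h4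
    omega

theorem IsElementarySlope.exists_rat {S : ℝ} (hS : IsElementarySlope S) :
    ∃ r : ℚ, (r : ℝ) = S := by
  by_contra hirr
  have hirr : Irrational S := hirr
  have hS0 : 0 < S := hS.1
  have hS1 : S < 1 := hS.2.1
  obtain ⟨y, a, b, L, -, -, hlink, hw, ha, hb⟩ := hS.exists_distances
  have hit : ∀ u v : ℝ, 0 ≤ u → u < v → v ≤ S → ∃ N : ℕ,
      u < y + S * L N - 3 * N ∧ y + S * L N - 3 * N < v := fun u v hu huv hv => by
    obtain ⟨n, m, h1, h2⟩ := exists_nat_sub_mul_add_mul_mem_Ioo hS0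
      (c := 3) (by exact_mod_cast hirr.natCast_div (m := 3) (by norm_num)) y huv
    obtain ⟨h3, h4⟩ := hw n
    have h5 : (m : ℝ) < L n + 1 := lt_of_mul_lt_mul_left (a := S) (by linarith) hS0.le
    have h6 : (L n : ℝ) < m + 1 := lt_of_mul_lt_mul_left (a := S) (by linarith) hS0.le
    -- Both representatives modulo S lie in [0, S], one of them strictly inside.
    have h7 : m = L n := by
      have h5' : m < (L n : ℤ) + 1 := by exact_mod_cast h5
      have h6' : (L n : ℤ) < m + 1 := by exact_mod_cast h6
      omega
    rw [h7, Int.cast_natCast] at h1 h2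
    exact ⟨n, by linarith, by linarith⟩
  have hfloor : ∀ c : ℕ, 0 < c → ∃ D : ℕ, (D : ℝ) * S < c ∧ (c : ℝ) < (D + 1) * S := fun c hc => by
    refine ⟨⌊(c : ℝ) / S⌋₊, lt_of_le_of_ne ?_ ?_, ?_⟩
    · exact (le_div_iff₀ hS0).1 (Nat.floor_le (by positivity))
    · intro h
      have h0 : (⌊(c : ℝ) / S⌋₊ : ℝ) ≠ 0 := by
        rintro h0
        rw [h0, zero_mul] at h
        exact hc.ne' (by exact_mod_cast h.symm)
      exact hirr ⟨(c : ℚ) / (⌊(c : ℝ) / S⌋₊ : ℕ), by push_cast; field_simp; linarith⟩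
    · exact (div_lt_iff₀ hS0).1 (Nat.lt_floor_add_one _)
  obtain ⟨k, hk1, hk2⟩ := hfloor 1 one_pos
  obtain ⟨D, hD1, hD2⟩ := hfloor 3 three_pos
  push_cast at hk1 hk2 hD1 hD2
  have first N := eq_of_mul_mem_Ioo hS0 hk1.le (hw N).1 (hw N).2 hk2 (ha N).1 (ha N).2
  have third N := eq_of_mul_mem_Ioo hS0 hD1.le (hw N).1 (hw N).2 hD2 (hb N).1 (hb N).2
  have hkD : k + 1 < D := by
    have : ((k : ℝ) + 1) < D + 1 - 1 := lt_of_mul_lt_mul_left (a := S) (by linarith) hS0.le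
    have : ((k + 1 : ℕ) : ℝ) < D := by push_cast; linarith
    exact_mod_cast this
  rcases lt_trichotomy (1 - k * S) (3 - D * S) with h | h | h
  · obtain ⟨M, hM1, hM2⟩ := hit _ _ (by linarith) h (by linarith)
    obtain ⟨N, hN1, hN2⟩ := hit (3 - D * S) S (by linarith) (by linarith) le_rfl
    have h1 := hlink M
    have h2 := hlink N
    rw [(first M).2 hM1, (third M).1 hM2] at h1
    rw [(first N).2 (h.trans hN1), (third N).2 hN1] at h2
    exact h2.not_succ_right (by omega) h1
  · have h0 : (D : ℝ) - k ≠ 0 := fun h0 => by nlinarith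
    exact hirr ⟨2 / ((D : ℚ) - k), by push_cast; field_simp; linarith⟩
  · obtain ⟨M, hM1, hM2⟩ := hit 0 (3 - D * S) le_rfl (by linarith) (by linarith)
    obtain ⟨N, hN1, hN2⟩ := hit _ _ (by linarith) h (by linarith)
    have h1 := hlink M
    have h2 := hlink N
    rw [(first M).1 (hM2.trans h), (third M).1 hM2] at h1
    rw [(first N).1 hN2, (third N).2 hN1] at h2
    exact h2.not_succ_right (by omega) h1

/-! ### Rational slopes: rotation of p cells -/

theorem eq_zero_or_one_of_mul_mem_Ico {p s J x : ℤ} (hs0 : 0 ≤ s) (hsp : s < p) (hJ0 : 0 ≤ J)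
    (hJp : J < p) (h1 : s - J ≤ p * x) (h2 : p * x < s - J + p) :
    (J < s → x = 1) ∧ (s ≤ J → x = 0) := by
  have hp : 0 < p := hs0.trans_lt hsp
  constructor <;> intro h
  · have h3 : 0 < x := lt_of_mul_lt_mul_left (a := p) (by linarith) hp.le
    have h4 : x < 2 := lt_of_mul_lt_mul_left (a := p) (by linarith) hp.le
    omega
  · have h3 : -1 < x := lt_of_mul_lt_mul_left (a := p) (by linarith) hp.le
    have h4 : x < 1 := lt_of_mul_lt_mul_left (a := p) (by linarith) hp.le
    omega

theorem IsElementarySlope.exists_cells {p q : ℕ} (hp : 0 < p) (hq : 0 < q)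
    (hS : IsElementarySlope ((p : ℝ) / q)) :
    ∃ (J : ℕ → ℤ) (a b : ℕ → ℕ), (∀ N, Linked (a N) (b N)) ∧ (∀ N, 0 ≤ J N ∧ J N < p) ∧
      (∀ N, J N ≡ J 0 - 3 * q * N [ZMOD p]) ∧
      (∀ N, (q : ℤ) ≤ J N + p * a N ∧ J N + p * a N < q + p) ∧
      (∀ N, (3 * q : ℤ) ≤ J N + p * b N ∧ J N + p * b N < 3 * q + p) := by
  obtain ⟨y, a, b, L, hL0, -, hlink, hw, ha, hb⟩ := hS.exists_distances
  have hq' : (0 : ℝ) < q := by exact_mod_cast hq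
  have hJ0 := Int.floor_le (q * y)
  have hJ1 := Int.lt_floor_add_one (q * y)
  have key : ∀ N, (q : ℝ) * (y + p / q * L N - 3 * N) = q * y + p * L N - 3 * q * N := fun N => by
    field_simp
  have key' : ∀ n : ℕ, (q : ℝ) * (p / q * n) = p * n := fun n => by field_simp
  have key0 : (q : ℝ) * (p / q) = p := by field_simp
  -- This is the integer part of q w.
  refine ⟨fun N => ⌊q * y⌋ + p * L N - 3 * q * N, a, b, hlink, fun N => ?_, fun N => ?_,
    fun N => ?_, fun N => ?_⟩
  · obtain ⟨h1, h2⟩ := hw N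
    have h1 := mul_lt_mul_of_pos_left h1 hq'
    have h2 := mul_lt_mul_of_pos_left h2 hq'
    rw [key] at h1 h2
    rw [key0] at h2
    constructor
    · rw [← Int.lt_add_one_iff]
      have : (0 : ℝ) < ⌊q * y⌋ + p * L N - 3 * q * N + 1 := by linarith
      exact_mod_cast this
    · have : (⌊q * y⌋ + p * L N - 3 * q * N : ℝ) < p := by linarith
      exact_mod_cast this
  · rw [Int.modEq_iff_dvd]
    exact ⟨-L N, by simp [hL0]⟩
  · obtain ⟨h1, h2⟩ := ha N
    have h1 := mul_lt_mul_of_pos_left h1 hq'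
    have h2 := mul_lt_mul_of_pos_left h2 hq'
    rw [mul_add, key, key'] at h1 h2
    rw [mul_add, key0] at h2
    constructor
    · rw [← Int.lt_add_one_iff]
      have : (q : ℝ) < ⌊q * y⌋ + p * L N - 3 * q * N + p * a N + 1 := by linarith
      exact_mod_cast this
    · have : (⌊q * y⌋ + p * L N - 3 * q * N + p * a N : ℝ) < q + p := by linarith
      exact_mod_cast this
  · obtain ⟨h1, h2⟩ := hb N
    have h1 := mul_lt_mul_of_pos_left h1 hq'
    have h2 := mul_lt_mul_of_pos_left h2 hq'
    rw [mul_add, key, key'] at h1 h2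
    rw [mul_add, key0] at h2
    constructor
    · rw [← Int.lt_add_one_iff]
      have : (3 * q : ℝ) < ⌊q * y⌋ + p * L N - 3 * q * N + p * b N + 1 := by linarith
      exact_mod_cast this
    · have : (⌊q * y⌋ + p * L N - 3 * q * N + p * b N : ℝ) < 3 * q + p := by linarith
      exact_mod_cast this

/-- The residues `J₀ - 3 q N` modulo `p` fill the class of `J₀` modulo the ideal generated by `3`
and `p`. -/
theorem exists_nat_sub_three_mul_modEq {p q : ℕ} (hp : 0 < p) (hpq : Nat.Coprime p q) (J₀ j u v : ℤ)
    (h : J₀ - j = 3 * u + p * v) : ∃ N : ℕ, J₀ - 3 * q * N ≡ j [ZMOD p] := by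
  have hb := Nat.gcd_eq_gcd_ab p q
  rw [hpq] at hb
  set x := u * p.gcdB q
  have hp' : (0 : ℤ) < p := by exact_mod_cast hp
  -- N is u times the inverse of q modulo p, from Bézout.
  refine ⟨(x % p).toNat, ?_⟩
  rw [Int.toNat_of_nonneg (Int.emod_nonneg _ hp'.ne'), Int.modEq_iff_dvd]
  refine ⟨-v - 3 * u * p.gcdA q - 3 * q * (x / p), ?_⟩
  have h1 := Int.emod_add_mul_ediv x p
  push_cast at hb
  have h2 : u = u * (p * p.gcdA q + q * p.gcdB q) := by rw [← hb, mul_one]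
  have h3 : x % p = u * p.gcdB q - p * (x / p) := by linarith
  rw [h3]
  linear_combination (-1) * h - 3 * h2

theorem IsElementarySlope.arithmetic {p q : ℕ} (hp : 0 < p) (hq : 0 < q) (hpq : Nat.Coprime p q)
    (hS : IsElementarySlope ((p : ℝ) / q)) :
    (p = 1 ∨ 3 ∣ p) ∧ (p ≠ 1 → q ≡ 1 [MOD p] ∨ q ≡ p - 1 [MOD p]) := by
  rcases eq_or_ne p 1 with rfl | hp1
  · simp
  have hpq' : p < q := by
    have := hS.2.1
    rw [div_lt_one (by exact_mod_cast hq)] at this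
    exact_mod_cast this
  obtain ⟨J, a, b, hlink, hJ, hmod, ha, hb⟩ := hS.exists_cells hp hq
  obtain ⟨k, r, hk, hrp, hqk⟩ : ∃ k r : ℕ, 0 < k ∧ r < p ∧ q = p * k + r :=
    ⟨q / p, q % p, Nat.div_pos hpq'.le hp, Nat.mod_lt _ hp, (Nat.div_add_mod q p).symm⟩
  have hcop : Nat.Coprime p r := by
    rw [hqk] at hpq
    simpa using hpq
  obtain ⟨c, β, hβp, hcβ⟩ : ∃ c β : ℕ, β < p ∧ 3 * r = p * c + β :=
    ⟨3 * r / p, 3 * r % p, Nat.mod_lt _ hp, (Nat.div_add_mod _ p).symm⟩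
  have hr0 : r ≠ 0 := by
    rintro rfl
    exact hp1 (by simpa using hcop)
  have hc3 : c < 3 := lt_of_mul_lt_mul_left (a := p) (by omega) hp.le
  have hqk' : (q : ℤ) = p * k + r := by exact_mod_cast hqk
  have hcβ' : (3 * r : ℤ) = p * c + β := by exact_mod_cast hcβ
  have first : ∀ N, (J N < r → a N = k + 1) ∧ ((r : ℤ) ≤ J N → a N = k) := fun N => by
    obtain ⟨h1, h2⟩ := eq_zero_or_one_of_mul_mem_Ico (x := (a N : ℤ) - k) (s := (r : ℤ)) (p := p)
      (by omega) (by omega) (hJ N).1 (hJ N).2 (by linarith [(ha N).1]) (by linarith [(ha N).2])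
    exact ⟨fun h => by have := h1 h; omega, fun h => by have := h2 h; omega⟩
  have third : ∀ N, (J N < β → b N = 3 * k + c + 1) ∧ ((β : ℤ) ≤ J N → b N = 3 * k + c) := fun N => by
    obtain ⟨h1, h2⟩ := eq_zero_or_one_of_mul_mem_Ico (x := (b N : ℤ) - (3 * k + c)) (s := (β : ℤ))
      (p := p) (by omega) (by omega) (hJ N).1 (hJ N).2 (by linarith [(hb N).1])
      (by linarith [(hb N).2])
    exact ⟨fun h => by have := h1 h; omega, fun h => by have := h2 h; omega⟩
  have link : ∀ j u v : ℤ, 0 ≤ j → j < p → J 0 - j = 3 * u + p * v →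
      Linked (if j < r then k + 1 else k) (if j < β then 3 * k + c + 1 else 3 * k + c) :=
    fun j u v hj0 hjp h => by
      obtain ⟨N, hN⟩ := exists_nat_sub_three_mul_modEq hp hpq _ _ _ _ h
      have hj : J N = j := by
        have := (hmod N).trans hN
        rwa [Int.ModEq, Int.emod_eq_of_lt (hJ N).1 (hJ N).2, Int.emod_eq_of_lt hj0 hjp] at this
      have hl := hlink N
      rw [← hj]
      split_ifs with h1 h2 h2
      · rwa [(first N).1 h1, (third N).1 h2] at hl
      · rwa [(first N).1 h1, (third N).2 (not_lt.1 h2)] at hl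
      · rwa [(first N).2 (not_lt.1 h1), (third N).1 h2] at hl
      · rwa [(first N).2 (not_lt.1 h1), (third N).2 (not_lt.1 h2)] at hl
  have excl : ∀ m, m ≤ k + 1 → Linked m (3 * k + c) → ¬ Linked m (3 * k + c + 1) :=
    fun m hm h => h.not_succ_right (by omega)
  suffices h : (3 ∣ p) ∧ (r = 1 ∨ r = p - 1) by
    refine ⟨Or.inr h.1, fun _ => ?_⟩
    have hmodr : q ≡ r [MOD p] := by simp [hqk, Nat.ModEq]
    rcases h.2 with rfl | rfl
    · exact Or.inl hmodr
    · exact Or.inr hmodr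
  by_cases h3 : 3 ∣ p
  · refine ⟨h3, ?_⟩
    obtain ⟨e, rfl⟩ := h3
    have hβ3 : (β : ℤ) = 3 * (r - e * c) := by push_cast at hcβ'; linarith
    by_cases hβ0 : β = 0
    · have hre : r = e * c := by
        have : (r : ℤ) = e * c := by rw [hβ0] at hβ3; push_cast at hβ3; linarith
        exact_mod_cast this
      have he : e = 1 := Nat.Coprime.eq_one_of_dvd
        (hcop.coprime_dvd_left (Dvd.intro_left 3 rfl)) (Dvd.intro c hre.symm)
      omega
    -- As 3 divides β, the cells β - 3 + t and β + t, with t = J 0 % 3, are the visited neighbours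
    -- of the threshold β.
    have hβ : ∃ t : ℤ, (β : ℤ) = 3 * t := ⟨_, hβ3⟩
    have l1 := link (β - 3 + J 0 % 3) ((J 0 - (β - 3 + J 0 % 3)) / 3) 0
      (by omega) (by omega) (by omega)
    have l2 := link (β + J 0 % 3) ((J 0 - (β + J 0 % 3)) / 3) 0
      (by omega) (by omega) (by omega)
    rw [if_pos (by omega : (β : ℤ) - 3 + J 0 % 3 < β)] at l1
    rw [if_neg (by omega : ¬ (β : ℤ) + J 0 % 3 < β)] at l2
    by_cases hr1 : (r : ℤ) ≤ β - 3 + J 0 % 3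
    · rw [if_neg (by omega)] at l1 l2
      exact absurd l1 (excl _ (by omega) l2)
    by_cases hr2 : (β : ℤ) + J 0 % 3 < r
    · rw [if_pos (by omega)] at l1 l2
      exact absurd l1 (excl _ (by omega) l2)
    rw [if_pos (by omega)] at l1
    rw [if_neg (by omega)] at l2
    -- Now r lies between these cells: c = 0 gives r = 1, c = 2 gives r = p - 1.
    interval_cases c
    · omega
    · exact absurd l1 l2.not_three_mul_add_one
    · omega
  · exfalso
    have link' : ∀ j : ℤ, 0 ≤ j → j < p →
        Linked (if j < r then k + 1 else k) (if j < β then 3 * k + c + 1 else 3 * k + c) :=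
      fun j hj0 hjp => by
        rcases (by omega : p % 3 = 1 ∨ p % 3 = 2) with h | h
        · have hp3 : (p : ℤ) = 3 * (p / 3 : ℕ) + 1 := by omega
          exact link j (-((p / 3 : ℕ) * (J 0 - j))) (J 0 - j) hj0 hjp (by
            linear_combination (j - J 0) * hp3)
        · have hp3 : (p : ℤ) = 3 * (p / 3 : ℕ) + 2 := by omega
          exact link j (((p / 3 : ℕ) + 1) * (J 0 - j)) (j - J 0) hj0 hjp (by
            linear_combination (J 0 - j) * hp3)
    have hβ0 : β ≠ 0 := by
      rintro rfl
      have hp3 : p ∣ 3 := hcop.dvd_of_dvd_mul_right (Dvd.intro c hcβ.symm)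
      rcases (Nat.dvd_prime Nat.prime_three).1 hp3 with h | h
      · exact hp1 h
      · exact h3 (h ▸ dvd_rfl)
    have l2 := link' β (by omega) (by omega)
    rw [if_neg (lt_irrefl _)] at l2
    have l0 := link' 0 (by omega) (by omega)
    rw [if_pos (by omega), if_pos (by omega)] at l0
    rcases lt_trichotomy r β with h | h | h
    · have l1 := link' r (by omega) (by omega)
      rw [if_neg (lt_irrefl _), if_pos (by omega)] at l1
      rw [if_neg (by omega)] at l2
      exact excl _ (by omega) l2 l1
    · rw [if_neg (by omega)] at l2
      -- Here r = β, so 2r = pc with 0 < r < p, leaving only c = 1.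
      interval_cases c
      · omega
      · exact l2.not_three_mul_add_one l0
      · omega
    · rw [if_pos (by omega)] at l2
      exact excl _ (by omega) l2 l0

end Breakout

theorem mainTheorem1 :
    (∀ S : ℝ, Breakout.IsElementarySlope S → ∃ r : ℚ, (r : ℝ) = S) ∧
    (∀ p q : ℕ, 0 < p → 0 < q → Nat.Coprime p q →
      Breakout.IsElementarySlope ((p : ℝ) / (q : ℝ)) →
      (p = 1 ∨ 3 ∣ p) ∧ (p ≠ 1 → q ≡ 1 [MOD p] ∨ q ≡ p - 1 [MOD p])) :=
  ⟨fun _ hS => hS.exists_rat, fun _ _ hp hq hpq hS => hS.arithmetic hp hq hpq⟩
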